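/- Let $k,m,n$ be non-negative integers, let $M_k$ denote the complex $k\times k$ matrices, and identify $M_k\otimes M_m$ with $M_{km}$ via the Kronecker product. Let $A=\sum_{i=1}^n A_i\otimes B_i\in M_k\otimes M_m$ (with $A_i\in M_k$, $B_i\in M_m$) be a positive semidefinite Hermitian matrix. If either $k\neq m$ and $\dim\ker A<\min\{k,m\}$, or $k=m$ and $\dim\ker A<k-1$, then $A$ can be put in filter normal form with the same number $n$ of terms; that is, $n\ge 1$ and there are invertible matrices $X'\in M_k$, $Y'\in M_m$ and matrices $C_1,\dots,C_n\in M_k$, $D_1,\dots,D_n\in M_m$ such that $$(X'\otimes Y')\,A\,(X'\otimes Y')^*=\sum_{i=1}^n C_i\otimes D_i,\qquad C_1=\frac{\mathrm{Id}}{\sqrt{k}},\qquad D_1=\frac{\mathrm{Id}}{\sqrt{m}},$$ and $\operatorname{tr}(C_iC_j)=\operatorname{tr}(D_iD_j)=0$ for all $i\neq j$. -/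

import Mathlib

open scoped Kronecker ComplexOrder

/-- `A ∈ M_k ⊗ M_m ≃ M_{km}` (identified through the Kronecker product) can be put in the filter
normal form with `n` terms: there are invertible `X ∈ M_k`, `Y ∈ M_m` such that
`(X ⊗ Y) A (X ⊗ Y)^* = ∑ i, C i ⊗ D i` with first terms `C_1 = Id / √k`, `D_1 = Id / √m` and
`tr (C_i C_j) = tr (D_i D_j) = 0` for all `i ≠ j`. -/
def HasFilterNormalForm {k m : ℕ} (n : ℕ)
    (A : Matrix (Fin k × Fin m) (Fin k × Fin m) ℂ) : Prop :=
  ∃ (X : Matrix (Fin k) (Fin k) ℂ) (Y : Matrix (Fin m) (Fin m) ℂ),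
    IsUnit X ∧ IsUnit Y ∧
    ∃ (C : Fin n → Matrix (Fin k) (Fin k) ℂ) (D : Fin n → Matrix (Fin m) (Fin m) ℂ),
      (X ⊗ₖ Y) * A * (X ⊗ₖ Y).conjTranspose = ∑ i, C i ⊗ₖ D i ∧
      (∃ hn : 0 < n,
        C ⟨0, hn⟩ = ((Real.sqrt k : ℝ) : ℂ)⁻¹ • (1 : Matrix (Fin k) (Fin k) ℂ) ∧
        D ⟨0, hn⟩ = ((Real.sqrt m : ℝ) : ℂ)⁻¹ • (1 : Matrix (Fin m) (Fin m) ℂ)) ∧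
      ∀ i j, i ≠ j → (C i * C j).trace = 0 ∧ (D i * D j).trace = 0

/-! ### Bounds on positive sequences with product one -/

section RealBounds

/-! Minimise `tr ((X ⊗ Y) A (X ⊗ Y)^*)` over `det X = det Y = 1`. In eigenbases of `X^*X` and
`Y^*Y`, with eigenvalues `x i` and `y j` of product one, this trace is `∑ x i * y j * q i j`, where
`q` is the diagonal of `A` in a product orthonormal basis. Any more than `dim ker A` entries of `q`
have sum bounded below, so a bound on the trace bounds the smallest `x i * y j` on every box with
more than `dim ker A` cells. The kernel hypothesis is what makes these inequalities bound all `x i`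
and `y j` (`exists_bound_of_boxes`). Hence sublevel sets are compact and a minimiser exists
(`exists_minimizer_scalingTrace`).

At a minimiser, varying one factor sees only a partial trace, and stationarity forces it to be
scalar (`Matrix.IsHermitian.eq_smul_one_of_trace_le`). After rescaling, `Id/√k` and `Id/√m` form a
singular pair of singular value `1` for the real coefficient matrix of the scaled `A` in Hermitian
orthonormal bases. A singular value decomposition beginning with this pair is the normal form. It
needs at most `n` terms because the rank is at most `n`; zero terms fill the rest
(`exists_orthogonal_sum_vecMulVec`). -/

lemma one_le_mul_pow_of_prod_eq_one {n : ℕ} {a : Fin n → ℝ} {K : ℝ} (hK : 1 ≤ K)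
    (ha : ∀ i, 0 < a i) (h : ∀ i, a i ≤ K) (hp : ∏ i, a i = 1) (i : Fin n) :
    1 ≤ a i * K ^ n := by
  rw [← hp, ← Finset.mul_prod_erase _ _ (Finset.mem_univ i)]
  refine mul_le_mul_of_nonneg_left ?_ (ha i).le
  calc ∏ j ∈ Finset.univ.erase i, a j ≤ ∏ _j ∈ Finset.univ.erase i, K :=
        Finset.prod_le_prod (fun j _ => (ha j).le) (fun j _ => h j)
    _ = K ^ (n - 1) := by simp
    _ ≤ K ^ n := pow_le_pow_right₀ hK (Nat.sub_le _ _)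

/-- The antidiagonal products are at most `K` and multiply to one, so they are also bounded below.
The adjacent antidiagonal, available because `d < n - 1`, then bounds the ratio of consecutive `x`;
the smallest `x` is at most one. The main antidiagonal alone would allow `y i.rev = (x i)⁻¹` with
`x` unbounded. -/
lemma le_of_antitone_of_staircase_square {n d : ℕ} (hd : d + 1 < n) {x y : Fin n → ℝ} {K : ℝ}
    (hK : 1 ≤ K) (hx : ∀ i, 0 < x i) (hy : ∀ i, 0 < y i) (hxa : Antitone x)
    (hxp : ∏ i, x i = 1) (hyp : ∏ i, y i = 1)
    (h : ∀ i j : Fin n, d < (i + 1 : ℕ) * (j + 1) → x i * y j ≤ K) (i : Fin n) :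
    x i ≤ (K ^ (n + 1)) ^ n := by
  have hK0 : 0 < K := by linarith
  have hdiag : ∀ i : Fin n, 1 ≤ x i * y i.rev * K ^ n := by
    refine one_le_mul_pow_of_prod_eq_one hK (fun i => mul_pos (hx _) (hy _)) (fun i => h _ _ ?_) ?_
    · have h1 := i.2
      have : ((i.rev : Fin n) : ℕ) = n - (i + 1) := Fin.val_rev i
      rw [this]
      obtain ⟨r, hr⟩ : ∃ r, n = i + 1 + r := ⟨n - (i + 1), by omega⟩
      have : n - (i + 1 : ℕ) = r := by omega
      rw [this]
      nlinarith [Nat.zero_le ((i : ℕ) * r)]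
    · rw [Finset.prod_mul_distrib, hxp, one_mul, ← hyp]
      exact Equiv.prod_comp Fin.revPerm y
  -- Both `x j` and `x (j+1)` are paired with the same entry of `y`. The cell of `x j` lies one step
  -- inside the antidiagonal, where `(j + 1) * (n - 1 - j) ≥ n - 1 > d`.
  have hstep : ∀ j (hj : j + 1 < n),
      x ⟨j, by omega⟩ ≤ x ⟨j + 1, hj⟩ * K ^ (n + 1) := by
    intro j hj
    have h1 := hdiag ⟨j + 1, hj⟩
    have h2 : x ⟨j, by omega⟩ * y (Fin.rev ⟨j + 1, hj⟩) ≤ K := by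
      apply h
      rw [Fin.val_rev]
      obtain ⟨r, hr⟩ : ∃ r, n = j + 1 + 1 + r := ⟨n - (j + 1 + 1), by omega⟩
      have : n - (j + 1 + 1 : ℕ) = r := by omega
      simp only [this]
      nlinarith [Nat.zero_le (j * r)]
    have hx1 := hx ⟨j + 1, hj⟩
    have hx0 := hx ⟨j, by omega⟩
    have hKn : 0 < K ^ n := by positivity
    calc x ⟨j, by omega⟩ ≤ x ⟨j, by omega⟩ * (x ⟨j + 1, hj⟩ * y (Fin.rev ⟨j + 1, hj⟩) * K ^ n) :=
          le_mul_of_one_le_right hx0.le h1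
      _ = (x ⟨j, by omega⟩ * y (Fin.rev ⟨j + 1, hj⟩)) * (x ⟨j + 1, hj⟩ * K ^ n) := by ring
      _ ≤ K * (x ⟨j + 1, hj⟩ * K ^ n) := by gcongr
      _ = _ := by ring
  have hall : ∀ j (hj : j < n), x ⟨0, by omega⟩ ≤ x ⟨j, hj⟩ * (K ^ (n + 1)) ^ j := by
    intro j
    induction j with
    | zero => intro hj; simp
    | succ j ih =>
      intro hj
      calc x ⟨0, by omega⟩ ≤ x ⟨j, by omega⟩ * (K ^ (n + 1)) ^ j := ih (by omega)
        _ ≤ (x ⟨j + 1, hj⟩ * K ^ (n + 1)) * (K ^ (n + 1)) ^ j := by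
          gcongr; exact hstep j hj
        _ = _ := by ring
  have hlast : x ⟨n - 1, by omega⟩ ≤ 1 := by
    by_contra hcon
    push Not at hcon
    have : ∀ i, 1 < x i := fun i => hcon.trans_le (hxa (Fin.le_def.2 (by simp; omega)))
    have h2 := Finset.prod_lt_prod_of_nonempty (s := Finset.univ) (f := fun _ : Fin n => (1 : ℝ))
      (g := x) (fun _ _ => one_pos) (fun i _ => this i) ⟨⟨0, by omega⟩, Finset.mem_univ _⟩
    simp [hxp] at h2
  calc x i ≤ x ⟨0, by omega⟩ := hxa (Fin.le_def.2 (by simp))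
    _ ≤ x ⟨n - 1, by omega⟩ * (K ^ (n + 1)) ^ (n - 1) := hall _ _
    _ ≤ 1 * (K ^ (n + 1)) ^ n := by
      gcongr
      · exact one_le_pow₀ hK
      · omega
    _ = _ := one_mul _

/-- The antidiagonal pairs all of `x` with the first `k` entries of `y`, whose product is therefore
at most `K ^ k`. As `∏ y = 1`, the tail is not small, so by monotonicity neither are those first `k`
entries. This bounds `x` above, hence below, and then bounds `y`. -/
lemma le_of_antitone_of_staircase_lt {k r d : ℕ} (hd : d < k) (hr : 0 < r) {x : Fin k → ℝ}
    {y : Fin (k + r) → ℝ} {K : ℝ} (hK : 1 ≤ K) (hx : ∀ i, 0 < x i) (hy : ∀ i, 0 < y i)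
    (hya : Antitone y) (hxp : ∏ i, x i = 1) (hyp : ∏ i, y i = 1)
    (h : ∀ (i : Fin k) (j : Fin (k + r)), d < (i + 1 : ℕ) * (j + 1) → x i * y j ≤ K) :
    (∀ i, x i ≤ K ^ (k + 1)) ∧ ∀ j, y j ≤ K * (K ^ (k + 1)) ^ k := by
  have hK0 : 0 < K := by linarith
  have hdiag : ∀ i : Fin k, x i * y (Fin.castAdd r i.rev) ≤ K := by
    intro i
    apply h
    rw [Fin.val_castAdd, Fin.val_rev]
    obtain ⟨s, hs⟩ : ∃ s, k = i + 1 + s := ⟨k - (i + 1), by omega⟩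
    have : k - (i + 1 : ℕ) = s := by omega
    rw [this]
    nlinarith [Nat.zero_le ((i : ℕ) * s)]
  have hP1 : ∏ i : Fin k, y (Fin.castAdd r i) ≤ K ^ k := by
    calc ∏ i : Fin k, y (Fin.castAdd r i) = ∏ i : Fin k, x i * y (Fin.castAdd r i.rev) := by
          rw [Finset.prod_mul_distrib, hxp, one_mul]
          exact (Equiv.prod_comp Fin.revPerm (fun i => y (Fin.castAdd r i))).symm
      _ ≤ ∏ _i : Fin k, K :=
          Finset.prod_le_prod (fun i _ => (mul_pos (hx _) (hy _)).le) (fun i _ => hdiag i)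
      _ = K ^ k := by simp
  -- This is the largest entry `z` of the tail, so the tail product is at most `z ^ r`, and `z ^ r ≤
  -- z` when `z ≤ 1`.
  have hmid : 1 ≤ K ^ k * y (Fin.natAdd k ⟨0, hr⟩) := by
    set z := y (Fin.natAdd k ⟨0, hr⟩) with hz
    have hz0 : 0 < z := hy _
    have h2 : ∏ i : Fin r, y (Fin.natAdd k i) ≤ z ^ r := by
      calc ∏ i : Fin r, y (Fin.natAdd k i) ≤ ∏ _i : Fin r, z :=
            Finset.prod_le_prod (fun i _ => (hy _).le)
              (fun i _ => hya (Fin.le_def.2 (by simp)))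
        _ = z ^ r := by simp
    have h3 : 1 ≤ K ^ k * z ^ r := by
      rw [← hyp, Fin.prod_univ_add]
      exact mul_le_mul hP1 h2 (Finset.prod_nonneg fun i _ => (hy _).le) (by positivity)
    rcases le_or_gt 1 z with hz1 | hz1
    · exact one_le_mul_of_one_le_of_one_le (one_le_pow₀ hK) hz1
    · refine h3.trans ?_
      gcongr
      exact pow_le_of_le_one hz0.le hz1.le hr.ne'
  have hylow : ∀ i : Fin k, 1 ≤ K ^ k * y (Fin.castAdd r i) := fun i =>
    hmid.trans (mul_le_mul_of_nonneg_left (hya (Fin.le_def.2 (by simp))) (by positivity))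
  have hxb : ∀ i, x i ≤ K ^ (k + 1) := by
    intro i
    calc x i ≤ x i * (K ^ k * y (Fin.castAdd r i.rev)) :=
          le_mul_of_one_le_right (hx i).le (hylow _)
      _ = (x i * y (Fin.castAdd r i.rev)) * K ^ k := by ring
      _ ≤ K * K ^ k := by gcongr; exact hdiag i
      _ = _ := by ring
  refine ⟨hxb, fun j => ?_⟩
  have hxlow := one_le_mul_pow_of_prod_eq_one (one_le_pow₀ hK) hx hxb hxp
  have hk : 0 < k := by omega
  have h0 := hdiag (Fin.rev ⟨0, hk⟩)
  rw [Fin.rev_rev] at h0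
  calc y j ≤ y (Fin.castAdd r ⟨0, hk⟩) := hya (Fin.le_def.2 (by simp))
    _ ≤ y (Fin.castAdd r ⟨0, hk⟩) * (x (Fin.rev ⟨0, hk⟩) * (K ^ (k + 1)) ^ k) :=
        le_mul_of_one_le_right (hy _).le (hxlow _)
    _ = (x (Fin.rev ⟨0, hk⟩) * y (Fin.castAdd r ⟨0, hk⟩)) * (K ^ (k + 1)) ^ k := by ring
    _ ≤ _ := by gcongr

lemma exists_bound_of_staircase {k m d : ℕ}
    (hd : (k ≠ m ∧ d < min k m) ∨ (k = m ∧ d + 1 < k)) (K : ℝ) :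
    ∃ R : ℝ, ∀ (x : Fin k → ℝ) (y : Fin m → ℝ), (∀ i, 0 < x i) → (∀ j, 0 < y j) →
      Antitone x → Antitone y → ∏ i, x i = 1 → ∏ j, y j = 1 →
      (∀ (i : Fin k) (j : Fin m), d < (i + 1 : ℕ) * (j + 1) → x i * y j ≤ K) →
      (∀ i, x i ≤ R) ∧ ∀ j, y j ≤ R := by
  set L := max K 1 with hL
  have hL1 : 1 ≤ L := le_max_right _ _
  have hKL : K ≤ L := le_max_left _ _
  rcases hd with ⟨hne, hd⟩ | ⟨rfl, hd⟩
  · rcases lt_or_gt_of_ne hne with hlt | hlt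
    · obtain ⟨r, rfl⟩ := Nat.exists_eq_add_of_lt hlt
      rw [add_assoc] at *
      refine ⟨max (L ^ (k + 1)) (L * (L ^ (k + 1)) ^ k), ?_⟩
      intro x y hx hy _ hya hxp hyp h
      have := le_of_antitone_of_staircase_lt (d := d) (lt_min_iff.1 hd).1 (Nat.succ_pos r) hL1 hx hy
        hya hxp hyp (fun i j hij => (h i j hij).trans hKL)
      exact ⟨fun i => (this.1 i).trans (le_max_left _ _),
        fun i => (this.2 i).trans (le_max_right _ _)⟩
    · obtain ⟨r, rfl⟩ := Nat.exists_eq_add_of_lt hlt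
      rw [add_assoc] at *
      refine ⟨max (L ^ (m + 1)) (L * (L ^ (m + 1)) ^ m), ?_⟩
      intro x y hx hy hxa _ hxp hyp h
      have := le_of_antitone_of_staircase_lt (d := d) (lt_min_iff.1 hd).2 (Nat.succ_pos r) hL1 hy hx
        hxa hyp hxp (fun i j hij => by
          rw [mul_comm]; exact (h j i (by rwa [mul_comm])).trans hKL)
      exact ⟨fun i => (this.2 i).trans (le_max_right _ _),
        fun i => (this.1 i).trans (le_max_left _ _)⟩
  · refine ⟨(L ^ (k + 1)) ^ k, ?_⟩
    intro x y hx hy hxa hya hxp hyp h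
    exact ⟨le_of_antitone_of_staircase_square hd hL1 hx hy hxa hxp hyp
        (fun i j hij => (h i j hij).trans hKL),
      le_of_antitone_of_staircase_square hd hL1 hy hx hya hyp hxp
        (fun i j hij => by rw [mul_comm]; exact (h j i (by rwa [mul_comm])).trans hKL)⟩

lemma exists_perm_antitone {n : ℕ} (x : Fin n → ℝ) :
    ∃ σ : Equiv.Perm (Fin n), Antitone (x ∘ σ) := by
  refine ⟨Fin.revPerm.trans (Tuple.sort x), fun i j hij => ?_⟩
  exact Tuple.monotone_sort x (Fin.rev_le_rev.2 hij)

/-- Sorting both sequences reduces to the staircase form: the box of the `i + 1` largest `x` and `j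
+ 1` largest `y` has its minimum at its last corner, which serves as `t`. -/
lemma exists_bound_of_boxes {k m d : ℕ}
    (hd : (k ≠ m ∧ d < min k m) ∨ (k = m ∧ d + 1 < k)) (K : ℝ) :
    ∃ R : ℝ, ∀ (x : Fin k → ℝ) (y : Fin m → ℝ), (∀ i, 0 < x i) → (∀ j, 0 < y j) →
      ∏ i, x i = 1 → ∏ j, y j = 1 →
      (∀ (I : Finset (Fin k)) (J : Finset (Fin m)) (t : ℝ), 0 ≤ t → d < I.card * J.card →
        (∀ i ∈ I, ∀ j ∈ J, t ≤ x i * y j) → t ≤ K) →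
      (∀ i, x i ≤ R) ∧ ∀ j, y j ≤ R := by
  obtain ⟨R, hR⟩ := exists_bound_of_staircase hd K
  refine ⟨R, fun x y hx hy hxp hyp h => ?_⟩
  obtain ⟨σ, hσ⟩ := exists_perm_antitone x
  obtain ⟨τ, hτ⟩ := exists_perm_antitone y
  have key := hR (x ∘ σ) (y ∘ τ) (fun i => hx _) (fun j => hy _) hσ hτ
    (by rw [← hxp]; exact Equiv.prod_comp σ x) (by rw [← hyp]; exact Equiv.prod_comp τ y) ?_
  · exact ⟨fun i => by simpa using key.1 (σ.symm i), fun j => by simpa using key.2 (τ.symm j)⟩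
  · intro i j hij
    refine h ((Finset.Iic i).map σ.toEmbedding) ((Finset.Iic j).map τ.toEmbedding) _
      (mul_pos (hx _) (hy _)).le (by simpa using hij) ?_
    simp only [Finset.mem_map, Finset.mem_Iic, Equiv.coe_toEmbedding, forall_exists_index, and_imp,
      forall_apply_eq_imp_iff₂]
    intro i' hi' j' hj'
    exact mul_le_mul (hσ hi') (hτ hj') (hy _).le (hx _).le

end RealBounds

/-! ### Compactness of sublevel sets and existence of a minimiser -/

section Coercivity

open Matrix

lemma Matrix.IsHermitian.eq_mul_diagonal_mul_conjTranspose {ι : Type*} [Fintype ι] [DecidableEq ι]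
    {H : Matrix ι ι ℂ} (hH : H.IsHermitian) :
    H = (hH.eigenvectorUnitary : Matrix ι ι ℂ) * diagonal (fun i => (hH.eigenvalues i : ℂ)) *
      (hH.eigenvectorUnitary : Matrix ι ι ℂ)ᴴ := by
  conv_lhs => rw [hH.spectral_theorem, Unitary.conjStarAlgAut_apply]
  rfl

lemma mul_diagonal_mul_conjTranspose_apply_self {ι κ : Type*} [Fintype ι] [Fintype κ]
    [DecidableEq ι] (Z : Matrix κ ι ℂ) (a : ι → ℝ) (p : κ) :
    (Z * diagonal (fun i => (a i : ℂ)) * Zᴴ) p p = ((∑ l, a l * Complex.normSq (Z p l) : ℝ) : ℂ) := by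
  rw [Matrix.mul_apply]
  push_cast
  refine Finset.sum_congr rfl fun l _ => ?_
  rw [Matrix.mul_diagonal, conjTranspose_apply, Complex.normSq_eq_conj_mul_self, Complex.star_def]
  ring

lemma sum_normSq_row {ι : Type*} [Fintype ι] [DecidableEq ι] {Z : Matrix ι ι ℂ}
    (hZ : Z * Zᴴ = 1) (p : ι) : ∑ l, Complex.normSq (Z p l) = 1 := by
  have := mul_diagonal_mul_conjTranspose_apply_self Z (fun _ => 1) p
  simp only [Complex.ofReal_one, diagonal_one, mul_one, hZ, one_apply_eq, one_mul] at this
  exact_mod_cast this.symm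

lemma sum_normSq_col {ι : Type*} [Fintype ι] [DecidableEq ι] {Z : Matrix ι ι ℂ}
    (hZ : Zᴴ * Z = 1) (l : ι) : ∑ p, Complex.normSq (Z p l) = 1 := by
  have := sum_normSq_row (Z := Zᴴ) (by rwa [conjTranspose_conjTranspose]) l
  simpa [conjTranspose_apply] using this

/-- Compressing a positive semidefinite matrix to more orthonormal directions than its kernel has
dimensions leaves a trace bounded away from zero. -/
lemma Matrix.PosSemidef.exists_pos_le_sum_conj_diag {ι : Type*} [Fintype ι] [DecidableEq ι]
    {A : Matrix ι ι ℂ} (hA : A.PosSemidef) :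
    ∃ c : ℝ, 0 < c ∧ ∀ W : Matrix ι ι ℂ, Wᴴ * W = 1 → ∀ S : Finset ι,
      Module.finrank ℂ (LinearMap.ker A.mulVecLin) < S.card →
      c ≤ ∑ p ∈ S, ((Wᴴ * A * W) p p).re := by
  classical
  set a := hA.1.eigenvalues with ha
  set E := (hA.1.eigenvectorUnitary : Matrix ι ι ℂ) with hE
  have hAE : A = E * diagonal (fun i => (a i : ℂ)) * Eᴴ :=
    hA.1.eq_mul_diagonal_mul_conjTranspose
  have ha0 : ∀ i, 0 ≤ a i := hA.eigenvalues_nonneg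
  have hEE : E * Eᴴ = 1 := Unitary.coe_mul_star_self _
  -- `c` is the least nonzero eigenvalue of `A`, or `1` if there is none.
  obtain ⟨c, hc, hca⟩ : ∃ c : ℝ, 0 < c ∧ ∀ l, a l ≠ 0 → c ≤ a l := by
    have hfin : (Set.range fun l : {l // a l ≠ 0} => a l).Finite := Set.finite_range _
    rcases isEmpty_or_nonempty {l // a l ≠ 0} with he | he
    · exact ⟨1, one_pos, fun l hl => (he.false ⟨l, hl⟩).elim⟩
    · obtain ⟨l, hl⟩ := Finite.exists_min fun l : {l // a l ≠ 0} => a l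
      exact ⟨a l, (ha0 l).lt_of_ne' l.2, fun l' hl' => hl ⟨l', hl'⟩⟩
  refine ⟨c, hc, fun W hW S hS => ?_⟩
  have hWW : W * Wᴴ = 1 := mul_eq_one_comm.1 hW
  set Z := Wᴴ * E with hZ
  have hZ1 : Z * Zᴴ = 1 := by
    rw [hZ, conjTranspose_mul, conjTranspose_conjTranspose, Matrix.mul_assoc,
      ← Matrix.mul_assoc E, hEE, Matrix.one_mul, hW]
  have hZ2 : Zᴴ * Z = 1 := mul_eq_one_comm.1 hZ1
  have hQ : Wᴴ * A * W = Z * diagonal (fun i => (a i : ℂ)) * Zᴴ := by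
    rw [hZ, conjTranspose_mul, conjTranspose_conjTranspose]
    nth_rewrite 1 [hAE]
    simp only [Matrix.mul_assoc]
  have hker : (Finset.univ.filter fun l => a l = 0).card =
      Module.finrank ℂ (LinearMap.ker A.mulVecLin) := by
    have h1 := hA.1.rank_eq_card_non_zero_eigs
    have h2 := A.mulVecLin.finrank_range_add_finrank_ker
    rw [Matrix.rank] at h1
    rw [h1, Fintype.card_subtype, Module.finrank_fintype_fun_eq_card, ← Finset.card_univ,
      ← Finset.card_filter_add_card_filter_not (s := Finset.univ) (fun l => a l = 0)] at h2
    change (Finset.univ.filter fun l => ¬ a l = 0).card + _ = _ at h2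
    omega
  -- Row `p` of the unitary `Z` expands the `p`-th direction in eigenvectors of `A`; only its mass
  -- outside the kernel counts, with weight at least `c`.
  have hterm : ∀ p, c * (1 - ∑ l with a l = 0, Complex.normSq (Z p l)) ≤
      ((Wᴴ * A * W) p p).re := by
    intro p
    rw [hQ, mul_diagonal_mul_conjTranspose_apply_self, Complex.ofReal_re, ← sum_normSq_row hZ1 p,
      ← Finset.sum_filter_add_sum_filter_not (s := Finset.univ) (fun l => a l = 0),
      add_sub_cancel_left, Finset.mul_sum]
    calc _ ≤ ∑ l with ¬ a l = 0, a l * Complex.normSq (Z p l) :=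
          Finset.sum_le_sum fun l hl => mul_le_mul_of_nonneg_right
            (hca l (Finset.mem_filter.1 hl).2) (Complex.normSq_nonneg _)
      _ ≤ _ := Finset.sum_le_univ_sum_of_nonneg
          fun l => mul_nonneg (ha0 l) (Complex.normSq_nonneg _)
  -- Columns of `Z` are unit vectors, so each kernel direction absorbs total mass at most one. The
  -- sum over `S` is thus at least `c * (S.card - dim ker A) ≥ c`.
  have hdef : ∑ p ∈ S, ∑ l with a l = 0, Complex.normSq (Z p l) ≤
      Module.finrank ℂ (LinearMap.ker A.mulVecLin) := by
    rw [Finset.sum_comm, ← hker]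
    calc ∑ l with a l = 0, ∑ p ∈ S, Complex.normSq (Z p l) ≤ ∑ l with a l = 0, (1 : ℝ) :=
          Finset.sum_le_sum fun l _ => (Finset.sum_le_univ_sum_of_nonneg
            fun p => Complex.normSq_nonneg _).trans_eq (sum_normSq_col hZ2 l)
      _ = _ := by simp
  have hS' : (Module.finrank ℂ (LinearMap.ker A.mulVecLin) : ℝ) + 1 ≤ S.card := by
    exact_mod_cast hS
  calc c ≤ c * ∑ p ∈ S, (1 - ∑ l with a l = 0, Complex.normSq (Z p l)) := by
        rw [Finset.sum_sub_distrib, Finset.sum_const, nsmul_eq_mul, mul_one]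
        nlinarith
    _ ≤ _ := by rw [Finset.mul_sum]; exact Finset.sum_le_sum fun p _ => hterm p

lemma det_conjTranspose_mul_self_of_det_eq_one {ι : Type*} [Fintype ι] [DecidableEq ι]
    {X : Matrix ι ι ℂ} (hX : X.det = 1) :
    (∀ i, 0 < (isHermitian_conjTranspose_mul_self X).eigenvalues i) ∧
      ∏ i, (isHermitian_conjTranspose_mul_self X).eigenvalues i = 1 := by
  have hp : ∏ i, (isHermitian_conjTranspose_mul_self X).eigenvalues i = 1 := by
    have := (isHermitian_conjTranspose_mul_self X).det_eq_prod_eigenvalues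
    rw [det_mul, det_conjTranspose, hX] at this
    simp only [star_one, mul_one] at this
    apply Complex.ofReal_injective
    rw [Complex.ofReal_prod, Complex.ofReal_one]
    exact this.symm
  refine ⟨fun i => lt_of_le_of_ne ((posSemidef_conjTranspose_mul_self X).eigenvalues_nonneg i)
    fun h => ?_, hp⟩
  rw [Finset.prod_eq_zero (Finset.mem_univ i) h.symm] at hp
  exact zero_ne_one hp

/-- The quantity `tr ((X ⊗ Y) A (X ⊗ Y)^*)`. -/
noncomputable def scalingTrace {k m : ℕ} (A : Matrix (Fin k × Fin m) (Fin k × Fin m) ℂ)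
    (X : Matrix (Fin k) (Fin k) ℂ) (Y : Matrix (Fin m) (Fin m) ℂ) : ℝ :=
  ((X ⊗ₖ Y) * A * (X ⊗ₖ Y)ᴴ).trace.re

/-- By cyclicity only `X^*X ⊗ Y^*Y` matters, and `W` is the tensor product of eigenbases of the two
factors. -/
lemma scalingTrace_eq_sum {k m : ℕ} (A : Matrix (Fin k × Fin m) (Fin k × Fin m) ℂ)
    (X : Matrix (Fin k) (Fin k) ℂ) (Y : Matrix (Fin m) (Fin m) ℂ) :
    ∃ W : Matrix (Fin k × Fin m) (Fin k × Fin m) ℂ, Wᴴ * W = 1 ∧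
      scalingTrace A X Y = ∑ p, (isHermitian_conjTranspose_mul_self X).eigenvalues p.1 *
        (isHermitian_conjTranspose_mul_self Y).eigenvalues p.2 * ((Wᴴ * A * W) p p).re := by
  set hX := isHermitian_conjTranspose_mul_self X
  set hY := isHermitian_conjTranspose_mul_self Y
  set U := (hX.eigenvectorUnitary : Matrix (Fin k) (Fin k) ℂ) with hU
  set V := (hY.eigenvectorUnitary : Matrix (Fin m) (Fin m) ℂ) with hV
  have hUU : Uᴴ * U = 1 := Unitary.coe_star_mul_self _
  have hVV : Vᴴ * V = 1 := Unitary.coe_star_mul_self _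
  refine ⟨U ⊗ₖ V, ?_, ?_⟩
  · rw [conjTranspose_kronecker, ← mul_kronecker_mul, hUU, hVV, one_kronecker_one]
  · set W := U ⊗ₖ V with hW
    have hD : (X ⊗ₖ Y)ᴴ * (X ⊗ₖ Y) =
        W * diagonal (fun p : Fin k × Fin m => ((hX.eigenvalues p.1 : ℂ) * hY.eigenvalues p.2)) *
          Wᴴ := by
      rw [conjTranspose_kronecker, ← mul_kronecker_mul]
      conv_lhs =>
        rw [hX.eq_mul_diagonal_mul_conjTranspose, hY.eq_mul_diagonal_mul_conjTranspose,
          mul_kronecker_mul, mul_kronecker_mul, diagonal_kronecker_diagonal]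
      rw [hW, conjTranspose_kronecker]
    rw [scalingTrace, trace_mul_comm, ← Matrix.mul_assoc, hD, Matrix.mul_assoc, Matrix.mul_assoc,
      trace_mul_comm, Matrix.mul_assoc, Matrix.trace, Complex.re_sum]
    refine Finset.sum_congr rfl fun p _ => ?_
    rw [diag_apply, diagonal_mul, ← Complex.ofReal_mul, Complex.re_ofReal_mul, Matrix.mul_assoc]

/-- Keeping only the terms of a box `I × J` with more than `dim ker A` cells, the trace is at least
`c` times any lower bound `s` for `x i * y j` there. So `s ≤ t / c`, which is the hypothesis of
`exists_bound_of_boxes`. -/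
lemma exists_bound_of_scalingTrace_le {k m : ℕ} {A : Matrix (Fin k × Fin m) (Fin k × Fin m) ℂ}
    (hA : A.PosSemidef)
    (hker : (k ≠ m ∧ Module.finrank ℂ (LinearMap.ker A.mulVecLin) < min k m) ∨
      (k = m ∧ Module.finrank ℂ (LinearMap.ker A.mulVecLin) + 1 < k)) (t : ℝ) :
    ∃ R : ℝ, ∀ (X : Matrix (Fin k) (Fin k) ℂ) (Y : Matrix (Fin m) (Fin m) ℂ), X.det = 1 →
      Y.det = 1 → scalingTrace A X Y ≤ t →
      (∀ i j, ‖X i j‖ ≤ R) ∧ ∀ i j, ‖Y i j‖ ≤ R := by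
  obtain ⟨c, hc, hcA⟩ := hA.exists_pos_le_sum_conj_diag
  obtain ⟨R, hR⟩ := exists_bound_of_boxes hker (t / c)
  have hentry : ∀ (l : ℕ) (Z : Matrix (Fin l) (Fin l) ℂ),
      (∀ i, (isHermitian_conjTranspose_mul_self Z).eigenvalues i ≤ R) → ∀ i j,
      ‖Z i j‖ ≤ √(l * R) := by
    intro l Z hZ i j
    refine Real.le_sqrt_of_sq_le ?_
    have h1 : ((Zᴴ * Z) j j).re ≤ (Zᴴ * Z).trace.re := by
      rw [Matrix.trace, Complex.re_sum]
      exact Finset.single_le_sum (f := fun j => ((Zᴴ * Z) j j).re)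
        (fun j _ => (Complex.nonneg_iff.1
          ((posSemidef_conjTranspose_mul_self Z).diag_nonneg (i := j))).1) (Finset.mem_univ j)
    have h2 : ‖Z i j‖ ^ 2 ≤ ((Zᴴ * Z) j j).re := by
      rw [Matrix.mul_apply, Complex.re_sum, ← Complex.normSq_eq_norm_sq]
      have : ∀ i, ((Zᴴ j i * Z i j).re) = Complex.normSq (Z i j) := by
        intro i
        rw [conjTranspose_apply, Complex.star_def, ← Complex.normSq_eq_conj_mul_self,
          Complex.ofReal_re]
      simp only [this]
      exact Finset.single_le_sum (f := fun i => Complex.normSq (Z i j))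
        (fun _ _ => Complex.normSq_nonneg _) (Finset.mem_univ i)
    refine h2.trans (h1.trans ?_)
    rw [(isHermitian_conjTranspose_mul_self Z).trace_eq_sum_eigenvalues, Complex.re_sum]
    calc _ ≤ ∑ _i : Fin l, R := Finset.sum_le_sum fun i _ => by simpa using hZ i
      _ = _ := by simp
  refine ⟨max (√(k * R)) (√(m * R)), fun X Y hX hY hXY => ?_⟩
  obtain ⟨hx, hxp⟩ := det_conjTranspose_mul_self_of_det_eq_one hX
  obtain ⟨hy, hyp⟩ := det_conjTranspose_mul_self_of_det_eq_one hY
  obtain ⟨W, hW, hWA⟩ := scalingTrace_eq_sum A X Y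
  have hb := hR _ _ hx hy hxp hyp ?_
  · exact ⟨fun i j => (hentry k X hb.1 i j).trans (le_max_left _ _),
      fun i j => (hentry m Y hb.2 i j).trans (le_max_right _ _)⟩
  · intro I J s hs hIJ hle
    rw [le_div_iff₀ hc]
    have hq : ∀ p, 0 ≤ ((Wᴴ * A * W) p p).re := fun p =>
      (Complex.nonneg_iff.1 ((hA.conjTranspose_mul_mul_same W).diag_nonneg (i := p))).1
    calc s * c ≤ s * ∑ p ∈ I ×ˢ J, ((Wᴴ * A * W) p p).re :=
          mul_le_mul_of_nonneg_left (hcA W hW _ (by rwa [Finset.card_product])) hs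
      _ ≤ ∑ p ∈ I ×ˢ J, (isHermitian_conjTranspose_mul_self X).eigenvalues p.1 *
          (isHermitian_conjTranspose_mul_self Y).eigenvalues p.2 * ((Wᴴ * A * W) p p).re := by
        rw [Finset.mul_sum]
        refine Finset.sum_le_sum fun p hp => mul_le_mul_of_nonneg_right ?_ (hq p)
        exact hle _ (Finset.mem_product.1 hp).1 _ (Finset.mem_product.1 hp).2
      _ ≤ _ := Finset.sum_le_univ_sum_of_nonneg
          fun p => mul_nonneg (mul_pos (hx _) (hy _)).le (hq p)
      _ ≤ t := hWA ▸ hXY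

lemma continuous_scalingTrace {k m : ℕ} (A : Matrix (Fin k × Fin m) (Fin k × Fin m) ℂ) :
    Continuous fun p : Matrix (Fin k) (Fin k) ℂ × Matrix (Fin m) (Fin m) ℂ =>
      scalingTrace A p.1 p.2 := by
  have hk : Continuous fun p : Matrix (Fin k) (Fin k) ℂ × Matrix (Fin m) (Fin m) ℂ =>
      p.1 ⊗ₖ p.2 := by
    refine continuous_matrix fun i j => ?_
    simp only [kroneckerMap_apply]
    exact (continuous_fst.matrix_elem _ _).mul (continuous_snd.matrix_elem _ _)
  exact Complex.continuous_re.comp ((hk.matrix_mul continuous_const).matrix_mul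
    hk.matrix_conjTranspose).matrix_trace

lemma exists_minimizer_scalingTrace {k m : ℕ} {A : Matrix (Fin k × Fin m) (Fin k × Fin m) ℂ}
    (hA : A.PosSemidef)
    (hker : (k ≠ m ∧ Module.finrank ℂ (LinearMap.ker A.mulVecLin) < min k m) ∨
      (k = m ∧ Module.finrank ℂ (LinearMap.ker A.mulVecLin) + 1 < k)) :
    ∃ (X : Matrix (Fin k) (Fin k) ℂ) (Y : Matrix (Fin m) (Fin m) ℂ), X.det = 1 ∧ Y.det = 1 ∧
      ∀ (X' : Matrix (Fin k) (Fin k) ℂ) (Y' : Matrix (Fin m) (Fin m) ℂ), X'.det = 1 →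
        Y'.det = 1 → scalingTrace A X Y ≤ scalingTrace A X' Y' := by
  obtain ⟨R, hR⟩ := exists_bound_of_scalingTrace_le hA hker (scalingTrace A 1 1)
  have hcpt : ∀ l : ℕ, IsCompact {Z : Matrix (Fin l) (Fin l) ℂ | ∀ i j, ‖Z i j‖ ≤ R} := by
    intro l
    have h := isCompact_univ_pi fun _ : Fin l =>
      isCompact_univ_pi fun _ : Fin l => isCompact_closedBall (0 : ℂ) R
    have e : {Z : Matrix (Fin l) (Fin l) ℂ | ∀ i j, ‖Z i j‖ ≤ R} =
        Set.univ.pi fun _ : Fin l => Set.univ.pi fun _ : Fin l => Metric.closedBall (0 : ℂ) R :=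
      Set.ext fun Z =>
        ⟨fun hZ i _ j _ => by simpa using hZ i j,
          fun hZ i j => by simpa using hZ i trivial j trivial⟩
    rw [e]
    exact h
  set S : Set (Matrix (Fin k) (Fin k) ℂ × Matrix (Fin m) (Fin m) ℂ) :=
    {p | p.1.det = 1 ∧ p.2.det = 1 ∧ scalingTrace A p.1 p.2 ≤ scalingTrace A 1 1} with hS
  have hclosed : IsClosed S :=
    (isClosed_eq continuous_fst.matrix_det continuous_const).inter
      ((isClosed_eq continuous_snd.matrix_det continuous_const).inter
        (isClosed_le (continuous_scalingTrace A) continuous_const))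
  have hScpt : IsCompact S := by
    refine ((hcpt k).prod (hcpt m)).of_isClosed_subset hclosed ?_
    rintro ⟨X, Y⟩ ⟨hX, hY, hXY⟩
    exact hR X Y hX hY hXY
  have h1 : ((1, 1) : Matrix (Fin k) (Fin k) ℂ × Matrix (Fin m) (Fin m) ℂ) ∈ S :=
    ⟨det_one, det_one, le_rfl⟩
  obtain ⟨⟨X, Y⟩, ⟨hX, hY, hXY⟩, hmin⟩ :=
    hScpt.exists_isMinOn ⟨_, h1⟩ (continuous_scalingTrace A).continuousOn
  refine ⟨X, Y, hX, hY, fun X' Y' hX' hY' => ?_⟩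
  rcases le_or_gt (scalingTrace A X' Y') (scalingTrace A 1 1) with h | h
  · exact isMinOn_iff.1 hmin (X', Y') ⟨hX', hY', h⟩
  · exact hXY.trans h.le

end Coercivity

/-! ### First-order conditions and scalar partial traces -/

section Stationarity

open Matrix

/-- If two eigenvalues differed, stretching one eigendirection by `t` and shrinking the other by
`t⁻¹` would lower the trace for `t` near one. -/
lemma Matrix.IsHermitian.eq_smul_one_of_trace_le {ι : Type*} [Fintype ι] [DecidableEq ι]
    {H : Matrix ι ι ℂ} (hH : H.IsHermitian)
    (h : ∀ Z : Matrix ι ι ℂ, Z.det = 1 → H.trace.re ≤ (Z * H * Zᴴ).trace.re) :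
    ∃ α : ℂ, H = α • (1 : Matrix ι ι ℂ) := by
  set a := hH.eigenvalues with ha
  set U := (hH.eigenvectorUnitary : Matrix ι ι ℂ) with hU
  have hHU : H = U * diagonal (fun i => (a i : ℂ)) * Uᴴ := hH.eq_mul_diagonal_mul_conjTranspose
  have hU1 : Uᴴ * U = 1 := Unitary.coe_star_mul_self _
  have hU2 : U * Uᴴ = 1 := Unitary.coe_mul_star_self _
  have hdiag : ∀ δ : ι → ℝ, ∏ i, δ i = 1 → ∑ i, a i ≤ ∑ i, a i * (δ i * δ i) := by
    intro δ hδ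
    have h1 := h (U * diagonal (fun i => (δ i : ℂ)) * Uᴴ) (by
      rw [det_mul_right_comm, hU2, Matrix.one_mul, det_diagonal, ← Complex.ofReal_prod, hδ,
        Complex.ofReal_one])
    have h2 : U * diagonal (fun i => (δ i : ℂ)) * Uᴴ * H * (U * diagonal (fun i => (δ i : ℂ)) * Uᴴ)ᴴ
        = U * diagonal (fun i => ((a i * (δ i * δ i) : ℝ) : ℂ)) * Uᴴ := by
      have h3 : (diagonal (fun i => (δ i : ℂ)))ᴴ = diagonal (fun i => (δ i : ℂ)) := by
        rw [diagonal_conjTranspose]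
        congr 1
        ext i
        simp
      rw [conjTranspose_mul, conjTranspose_mul, h3, conjTranspose_conjTranspose, hHU]
      calc _ = U * (diagonal (fun i => (δ i : ℂ)) * ((Uᴴ * U) * diagonal (fun i => (a i : ℂ)) *
            (Uᴴ * U)) * diagonal (fun i => (δ i : ℂ))) * Uᴴ := by simp only [Matrix.mul_assoc]
        _ = _ := by
          rw [hU1, Matrix.one_mul, Matrix.mul_one, diagonal_mul_diagonal, diagonal_mul_diagonal]
          congr 3
          ext i
          push_cast
          ring
    have h4 : ∀ b : ι → ℝ, (U * diagonal (fun i => (b i : ℂ)) * Uᴴ).trace.re = ∑ i, b i := by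
      intro b
      rw [trace_mul_comm, ← Matrix.mul_assoc, hU1, Matrix.one_mul, trace_diagonal,
        ← Complex.ofReal_sum, Complex.ofReal_re]
    rwa [h2, h4, hHU, h4] at h1
  have hle : ∀ i j, i ≠ j → a j ≤ a i := by
    intro i j hij
    by_contra hcon
    push Not at hcon
    have key : ∀ t : ℝ, 0 < t → a i + a j ≤ a i * (t * t) + a j * (t⁻¹ * t⁻¹) := by
      intro t ht
      have h1 := hdiag (fun l => if l = i then t else if l = j then t⁻¹ else 1) (by
        rw [Fintype.prod_eq_mul i j hij]
        · simp [hij.symm, ht.ne']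
        · intro l hl
          simp [hl.1, hl.2])
      have h2 : 0 ≤ ∑ l, (a l * ((if l = i then t else if l = j then t⁻¹ else 1) *
          (if l = i then t else if l = j then t⁻¹ else 1)) - a l) := by
        rw [Finset.sum_sub_distrib]
        linarith
      rw [Fintype.sum_eq_add i j hij] at h2
      · simp only [if_true, if_neg hij.symm] at h2
        linarith
      · intro l hl
        simp [hl.1, hl.2]
    -- With `s = t ^ 2`, the inequality `key` has the common factor `s - 1`; dividing it out leaves
    -- a bound that survives `s → 1`.
    have hmul : ∀ s : ℝ, 1 < s → a j ≤ a i * s := by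
      intro s hs
      have hs0 : 0 < s := by linarith
      have h1 := key (√s) (Real.sqrt_pos.2 hs0)
      rw [← mul_inv, Real.mul_self_sqrt hs0.le] at h1
      have h2 : s⁻¹ * s = 1 := inv_mul_cancel₀ hs0.ne'
      have h3 : (a i + a j) * s ≤ (a i * s + a j * s⁻¹) * s :=
        mul_le_mul_of_nonneg_right h1 hs0.le
      have h4 : (s - 1) * a j ≤ (s - 1) * (a i * s) := by
        have : a j * s⁻¹ * s = a j := by rw [mul_assoc, h2, mul_one]
        nlinarith
      exact le_of_mul_le_mul_left h4 (by linarith)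
    have hai : Filter.Tendsto (fun s : ℝ => a i * s) (nhdsWithin 1 (Set.Ioi 1)) (nhds (a i * 1)) :=
      ((continuous_const.mul continuous_id).tendsto 1).mono_left nhdsWithin_le_nhds
    have := ge_of_tendsto hai (b := a j)
      (Filter.eventually_of_mem self_mem_nhdsWithin fun s hs => hmul s hs)
    linarith
  have hconst : ∃ α : ℝ, a = fun _ => α := by
    rcases isEmpty_or_nonempty ι with he | ⟨⟨i⟩⟩
    · exact ⟨0, Subsingleton.elim _ _⟩
    · refine ⟨a i, funext fun j => ?_⟩
      by_cases hij : i = j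
      · rw [hij]
      · exact le_antisymm (hle i j hij) (hle j i (Ne.symm hij))
  obtain ⟨α, hα⟩ := hconst
  refine ⟨α, ?_⟩
  rw [hHU, hα, ← smul_one_eq_diagonal, Matrix.mul_smul, Matrix.mul_one, Matrix.smul_mul, hU2]

/-- The partial trace over the second tensor factor. -/
def partialTraceSnd {ι κ : Type*} [Fintype κ] (M : Matrix (ι × κ) (ι × κ) ℂ) : Matrix ι ι ℂ :=
  Matrix.of fun p q => ∑ r, M (p, r) (q, r)

/-- The partial trace over the first tensor factor. -/
def partialTraceFst {ι κ : Type*} [Fintype ι] (M : Matrix (ι × κ) (ι × κ) ℂ) : Matrix κ κ ℂ :=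
  Matrix.of fun r s => ∑ p, M (p, r) (p, s)

lemma isHermitian_partialTraceSnd {ι κ : Type*} [Fintype κ]
    {M : Matrix (ι × κ) (ι × κ) ℂ} (hM : M.IsHermitian) : (partialTraceSnd M).IsHermitian := by
  ext p q
  simp only [partialTraceSnd, conjTranspose_apply, of_apply, star_sum]
  exact Finset.sum_congr rfl fun r _ => hM.apply _ _

lemma isHermitian_partialTraceFst {ι κ : Type*} [Fintype ι]
    {M : Matrix (ι × κ) (ι × κ) ℂ} (hM : M.IsHermitian) : (partialTraceFst M).IsHermitian := by
  ext p q
  simp only [partialTraceFst, conjTranspose_apply, of_apply, star_sum]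
  exact Finset.sum_congr rfl fun r _ => hM.apply _ _

section PartialTrace

variable {ι κ : Type*} [Fintype ι] [Fintype κ]

lemma trace_partialTraceSnd (M : Matrix (ι × κ) (ι × κ) ℂ) :
    (partialTraceSnd M).trace = M.trace := by
  simp [Matrix.trace, partialTraceSnd, Fintype.sum_prod_type]

lemma trace_partialTraceFst (M : Matrix (ι × κ) (ι × κ) ℂ) :
    (partialTraceFst M).trace = M.trace := by
  simp [Matrix.trace, partialTraceFst, Fintype.sum_prod_type_right]

lemma trace_kronecker_one_mul [DecidableEq κ] (B : Matrix ι ι ℂ) (M : Matrix (ι × κ) (ι × κ) ℂ) :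
    ((B ⊗ₖ (1 : Matrix κ κ ℂ)) * M).trace = (B * partialTraceSnd M).trace := by
  simp only [Matrix.trace, diag_apply, Matrix.mul_apply, Fintype.sum_prod_type, kroneckerMap_apply,
    partialTraceSnd, of_apply, Finset.mul_sum]
  refine Finset.sum_congr rfl fun p _ => ?_
  rw [Finset.sum_comm]
  simp [one_apply]

lemma trace_one_kronecker_mul [DecidableEq ι] (B : Matrix κ κ ℂ) (M : Matrix (ι × κ) (ι × κ) ℂ) :
    (((1 : Matrix ι ι ℂ) ⊗ₖ B) * M).trace = (B * partialTraceFst M).trace := by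
  simp only [Matrix.trace, diag_apply, Matrix.mul_apply, Fintype.sum_prod_type_right,
    kroneckerMap_apply, partialTraceFst, of_apply, Finset.mul_sum]
  refine Finset.sum_congr rfl fun p _ => ?_
  rw [Finset.sum_comm]
  simp [one_apply]

/-- Moving one tensor factor only affects the trace through a partial trace, which turns joint
minimality into a condition on a single Hermitian matrix. -/
lemma trace_kronecker_one_conj [DecidableEq κ] (Z : Matrix ι ι ℂ) (M : Matrix (ι × κ) (ι × κ) ℂ) :
    ((Z ⊗ₖ (1 : Matrix κ κ ℂ)) * M * (Z ⊗ₖ (1 : Matrix κ κ ℂ))ᴴ).trace =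
      (Z * partialTraceSnd M * Zᴴ).trace := by
  rw [trace_mul_comm, ← Matrix.mul_assoc, conjTranspose_kronecker, ← mul_kronecker_mul,
    conjTranspose_one, Matrix.one_mul, trace_kronecker_one_mul, trace_mul_comm (Z * _),
    Matrix.mul_assoc]

lemma trace_one_kronecker_conj [DecidableEq ι] (Z : Matrix κ κ ℂ) (M : Matrix (ι × κ) (ι × κ) ℂ) :
    (((1 : Matrix ι ι ℂ) ⊗ₖ Z) * M * ((1 : Matrix ι ι ℂ) ⊗ₖ Z)ᴴ).trace =
      (Z * partialTraceFst M * Zᴴ).trace := by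
  rw [trace_mul_comm, ← Matrix.mul_assoc, conjTranspose_kronecker, ← mul_kronecker_mul,
    conjTranspose_one, Matrix.one_mul, trace_one_kronecker_mul, trace_mul_comm (Z * _),
    Matrix.mul_assoc]

end PartialTrace

lemma kronecker_conj_kronecker_conj {ι κ : Type*} [Fintype ι] [Fintype κ]
    (X Z : Matrix ι ι ℂ) (Y W : Matrix κ κ ℂ) (A : Matrix (ι × κ) (ι × κ) ℂ) :
    (Z ⊗ₖ W) * ((X ⊗ₖ Y) * A * (X ⊗ₖ Y)ᴴ) * (Z ⊗ₖ W)ᴴ =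
      ((Z * X) ⊗ₖ (W * Y)) * A * ((Z * X) ⊗ₖ (W * Y))ᴴ := by
  rw [mul_kronecker_mul, conjTranspose_mul]
  simp only [Matrix.mul_assoc]

/-- Operator scaling: local invertible transformations make both partial traces scalar. -/
lemma exists_scalar_partialTraces {k m : ℕ} {A : Matrix (Fin k × Fin m) (Fin k × Fin m) ℂ}
    (hA : A.PosSemidef)
    (hker : (k ≠ m ∧ Module.finrank ℂ (LinearMap.ker A.mulVecLin) < min k m) ∨
      (k = m ∧ Module.finrank ℂ (LinearMap.ker A.mulVecLin) + 1 < k)) :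
    ∃ (X : Matrix (Fin k) (Fin k) ℂ) (Y : Matrix (Fin m) (Fin m) ℂ), IsUnit X ∧ IsUnit Y ∧
      partialTraceSnd ((X ⊗ₖ Y) * A * (X ⊗ₖ Y)ᴴ) = ((√m / √k : ℝ) : ℂ) • 1 ∧
      partialTraceFst ((X ⊗ₖ Y) * A * (X ⊗ₖ Y)ᴴ) = ((√k / √m : ℝ) : ℂ) • 1 := by
  obtain ⟨X, Y, hX, hY, hmin⟩ := exists_minimizer_scalingTrace hA hker
  set M := (X ⊗ₖ Y) * A * (X ⊗ₖ Y)ᴴ with hM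
  have hMpos : M.PosSemidef := hA.mul_mul_conjTranspose_same _
  obtain ⟨α, hα⟩ := (isHermitian_partialTraceSnd hMpos.1).eq_smul_one_of_trace_le fun Z hZ => by
    rw [← trace_kronecker_one_conj, trace_partialTraceSnd, hM, kronecker_conj_kronecker_conj]
    exact hmin _ _ (by rw [det_mul, hZ, hX, one_mul]) (by rw [Matrix.one_mul, hY])
  obtain ⟨β, hβ⟩ := (isHermitian_partialTraceFst hMpos.1).eq_smul_one_of_trace_le fun Z hZ => by
    rw [← trace_one_kronecker_conj, trace_partialTraceFst, hM, kronecker_conj_kronecker_conj]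
    exact hmin _ _ (by rw [Matrix.one_mul, hX]) (by rw [det_mul, hZ, hY, one_mul])
  have hk : 0 < k := by omega
  have hm : 0 < m := by omega
  have hYu : IsUnit Y := (isUnit_iff_isUnit_det Y).2 (by rw [hY]; exact isUnit_one)
  -- The kernel of the zero matrix has dimension `k * m ≥ k`, too large for `hker`.
  have hA0 : A ≠ 0 := by
    rintro rfl
    have h1 : Module.finrank ℂ (LinearMap.ker
        (0 : Matrix (Fin k × Fin m) (Fin k × Fin m) ℂ).mulVecLin) = k * m := by
      rw [mulVecLin_zero, LinearMap.ker_zero, finrank_top]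
      simp
    rw [h1] at hker
    have h2 : k ≤ k * m := Nat.le_mul_of_pos_right _ hm
    omega
  have hM0 : M ≠ 0 := by
    intro h0
    have hu : IsUnit (X ⊗ₖ Y) := (isUnit_iff_isUnit_det _).2 (by
      rw [det_kronecker, hX, hY, one_pow, one_pow, one_mul]; exact isUnit_one)
    rw [hM, ← star_eq_conjTranspose, hu.star.mul_left_eq_zero, hu.mul_right_eq_zero] at h0
    exact hA0 h0
  obtain ⟨τ, hτ0, hτ⟩ : ∃ τ : ℝ, 0 < τ ∧ M.trace = τ := by
    have h1 := Complex.nonneg_iff.1 hMpos.trace_nonneg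
    refine ⟨M.trace.re, lt_of_le_of_ne h1.1 fun h => hM0 (hMpos.trace_eq_zero_iff.1 ?_),
      Complex.ext (by simp) (by simpa using h1.2.symm)⟩
    exact Complex.ext (by simpa using h.symm) (by simpa using h1.2.symm)
  have hαk : α * k = τ := by
    have := trace_partialTraceSnd M
    rw [hα, trace_smul, trace_one, hτ] at this
    simpa using this
  have hβm : β * m = τ := by
    have := trace_partialTraceFst M
    rw [hβ, trace_smul, trace_one, hτ] at this
    simpa using this
  -- This makes the trace `√k * √m`, so that the coefficient on `Id/√k ⊗ Id/√m` becomes exactly `1`.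
  set c : ℝ := √(√k * √m / τ) with hc
  have hsk : 0 < √(k : ℝ) := Real.sqrt_pos.2 (by exact_mod_cast hk)
  have hsm : 0 < √(m : ℝ) := Real.sqrt_pos.2 (by exact_mod_cast hm)
  have hc0 : 0 < c := Real.sqrt_pos.2 (by positivity)
  have hcc : c * c = √k * √m / τ := Real.mul_self_sqrt (by positivity)
  have hkk : (√(k : ℝ) : ℂ) * √(k : ℝ) = k := by
    rw [← Complex.ofReal_mul, Real.mul_self_sqrt (Nat.cast_nonneg _), Complex.ofReal_natCast]
  have hmm : (√(m : ℝ) : ℂ) * √(m : ℝ) = m := by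
    rw [← Complex.ofReal_mul, Real.mul_self_sqrt (Nat.cast_nonneg _), Complex.ofReal_natCast]
  have hsk' : (√(k : ℝ) : ℂ) ≠ 0 := by exact_mod_cast hsk.ne'
  have hsm' : (√(m : ℝ) : ℂ) ≠ 0 := by exact_mod_cast hsm.ne'
  have hτ' : (τ : ℂ) ≠ 0 := by exact_mod_cast hτ0.ne'
  have hscale : (((c : ℂ) • X) ⊗ₖ Y) * A * (((c : ℂ) • X) ⊗ₖ Y)ᴴ = ((c * c : ℝ) : ℂ) • M := by
    rw [smul_kronecker, conjTranspose_smul, Matrix.smul_mul, Matrix.smul_mul, Matrix.mul_smul,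
      smul_smul, ← hM]
    simp
  refine ⟨(c : ℂ) • X, Y, ?_, hYu, ?_, ?_⟩
  · rw [isUnit_iff_isUnit_det, det_smul, hX, mul_one]
    exact (IsUnit.mk0 _ (by exact_mod_cast hc0.ne')).pow _
  · rw [hscale]
    have : partialTraceSnd (((c * c : ℝ) : ℂ) • M) = ((c * c : ℝ) : ℂ) • partialTraceSnd M := by
      ext p q
      simp [partialTraceSnd, Finset.mul_sum]
    rw [this, hα, smul_smul, hcc]
    congr 1
    push_cast
    rw [← hkk] at hαk
    field_simp
    linear_combination hαk
  · rw [hscale]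
    have : partialTraceFst (((c * c : ℝ) : ℂ) • M) = ((c * c : ℝ) : ℂ) • partialTraceFst M := by
      ext p q
      simp [partialTraceFst, Finset.mul_sum]
    rw [this, hβ, smul_smul, hcc]
    congr 1
    push_cast
    rw [← hmm] at hβm
    field_simp
    linear_combination hβm

end Stationarity

/-! ### Orthogonal Schmidt decomposition over the reals -/

section SchmidtDecomposition

open Matrix

lemma linearIndependent_of_dotProduct {I ι : Type*} [Fintype I] [Fintype ι] {w : I → ι → ℂ}
    (h : ∀ i j, i ≠ j → w i ⬝ᵥ w j = 0) (h0 : ∀ i, w i ⬝ᵥ w i ≠ 0) : LinearIndependent ℂ w := by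
  rw [Fintype.linearIndependent_iff]
  intro g hg j
  have h1 : (∑ i, g i • w i) ⬝ᵥ w j = 0 := by rw [hg, zero_dotProduct]
  rw [sum_dotProduct, Finset.sum_eq_single j (fun i _ hij => by rw [smul_dotProduct, h i j hij,
    smul_zero]) (by simp), smul_dotProduct, smul_eq_mul] at h1
  exact (mul_eq_zero.1 h1).resolve_right (h0 j)

lemma ofReal_comp_dotProduct {ι : Type*} [Fintype ι] (v w : ι → ℝ) :
    (fun i => (v i : ℂ)) ⬝ᵥ (fun i => (w i : ℂ)) = ((v ⬝ᵥ w : ℝ) : ℂ) := by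
  simp [dotProduct]

/-- A real matrix with `n` terms having a prescribed pair of unit singular vectors of singular
value `1` has an orthogonal decomposition into `n` terms that starts with this pair. -/
lemma exists_orthogonal_sum_vecMulVec {ι κ : Type*} [Fintype ι] [Fintype κ] {n : ℕ}
    {T : Matrix ι κ ℝ} {e : ι → ℝ} {f : κ → ℝ} (hf : T *ᵥ f = e) (he : e ᵥ* T = f)
    (hee : e ⬝ᵥ e = 1) {a : Fin n → ι → ℂ} {b : Fin n → κ → ℂ}
    (hT : T.map Complex.ofReal = ∑ l, vecMulVec (a l) (b l)) :
    ∃ (hn : 0 < n) (c : Fin n → ι → ℝ) (d : Fin n → κ → ℝ), T = ∑ l, vecMulVec (c l) (d l) ∧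
      c ⟨0, hn⟩ = e ∧ d ⟨0, hn⟩ = f ∧
      ∀ i j, i ≠ j → c i ⬝ᵥ c j = 0 ∧ d i ⬝ᵥ d j = 0 := by
  classical
  have hff : f ⬝ᵥ f = 1 := by
    nth_rewrite 1 [← he]
    rw [← dotProduct_mulVec, hf, hee]
  -- Deflation by the known singular pair. The other terms come from `NᵀN`: the columns of `V` are
  -- right singular vectors, and those of `P = N * V` are left ones scaled by their singular values.
  set N := T - vecMulVec e f with hN
  have hNf : N *ᵥ f = 0 := by
    rw [hN, sub_mulVec, hf, vecMulVec_mulVec, hff]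
    simp
  have heN : e ᵥ* N = 0 := by
    rw [hN, vecMul_sub, he, vecMul_vecMulVec, hee]
    simp
  have hS : (Nᵀ * N).IsHermitian := isHermitian_conjTranspose_mul_self N
  set V := (hS.eigenvectorUnitary : Matrix κ κ ℝ) with hV
  have hV1 : Vᵀ * V = 1 := Unitary.coe_star_mul_self hS.eigenvectorUnitary
  have hV2 : V * Vᵀ = 1 := Unitary.coe_mul_star_self hS.eigenvectorUnitary
  set P := N * V with hP
  have hNP : N = P * Vᵀ := by rw [hP, Matrix.mul_assoc, hV2, Matrix.mul_one]
  have hPP : Pᵀ * P = diagonal hS.eigenvalues := by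
    have h1 : Nᵀ * N = V * diagonal hS.eigenvalues * Vᵀ := by
      conv_lhs => rw [hS.spectral_theorem, Unitary.conjStarAlgAut_apply]
      rfl
    calc Pᵀ * P = Vᵀ * (Nᵀ * N) * V := by
          rw [hP, transpose_mul]; simp only [Matrix.mul_assoc]
      _ = (Vᵀ * V) * diagonal hS.eigenvalues * (Vᵀ * V) := by
          conv_lhs => rw [h1]
          simp only [Matrix.mul_assoc]
      _ = _ := by rw [hV1, Matrix.one_mul, Matrix.mul_one]
  have hPdot : ∀ i j, P.col i ⬝ᵥ P.col j = diagonal hS.eigenvalues i j := by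
    intro i j
    rw [← hPP]; rfl
  have hVdot : ∀ i j, V.col i ⬝ᵥ V.col j = (1 : Matrix κ κ ℝ) i j := by
    intro i j
    rw [← hV1]; rfl
  have hPoff : ∀ i j, i ≠ j → P.col i ⬝ᵥ P.col j = 0 := fun i j hij => by
    rw [hPdot, diagonal_apply_ne _ hij]
  have hVoff : ∀ i j, i ≠ j → V.col i ⬝ᵥ V.col j = 0 := fun i j hij => by
    rw [hVdot, one_apply_ne hij]
  have heP : ∀ j, e ⬝ᵥ P.col j = 0 := by
    intro j
    have : e ᵥ* P = 0 := by rw [hP, ← vecMul_vecMul, heN, zero_vecMul]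
    exact congrFun this j
  -- The restriction is needed: `f` itself lies in `ker N`, so it need not be orthogonal to the
  -- columns of `V` spanning that kernel. Those columns are discarded.
  have hfV : ∀ j, P.col j ≠ 0 → f ⬝ᵥ V.col j = 0 := by
    intro j hj
    have h1 : (Pᵀ * P) *ᵥ (Vᵀ *ᵥ f) = 0 := by
      rw [mulVec_mulVec, Matrix.mul_assoc, ← hNP, ← mulVec_mulVec, hNf, mulVec_zero]
    have h2 := congrFun h1 j
    rw [hPP, mulVec_diagonal, Pi.zero_apply, mul_eq_zero] at h2
    rcases h2 with h2 | h2
    · refine absurd (dotProduct_self_eq_zero.1 ?_) hj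
      rw [hPdot, diagonal_apply_eq, h2]
    · rw [dotProduct_comm]; exact h2
  have hTP : ∀ j, P.col j ≠ 0 → T *ᵥ V.col j = P.col j := by
    intro j hj
    have h1 : T = N + vecMulVec e f := by rw [hN, sub_add_cancel]
    rw [h1, add_mulVec, vecMulVec_mulVec, hfV j hj]
    simp only [MulOpposite.op_zero, zero_smul, add_zero]
    rfl
  have hmem : ∀ z : κ → ℝ, (fun i => ((T *ᵥ z) i : ℂ)) ∈ Submodule.span ℂ (Set.range a) := by
    intro z
    have h1 : (fun i => ((T *ᵥ z) i : ℂ)) = T.map Complex.ofReal *ᵥ (fun j => (z j : ℂ)) := by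
      ext i
      simp [mulVec, dotProduct]
    rw [h1, hT, sum_mulVec]
    refine Submodule.sum_mem _ fun l _ => ?_
    rw [vecMulVec_mulVec, op_smul_eq_smul]
    exact Submodule.smul_mem _ _ (Submodule.subset_span ⟨l, rfl⟩)
  -- `e` and the nonzero columns of `P` are orthogonal and lie in the range of `T`, hence in the
  -- span of the `n` vectors `a l`. The span is complex because the given terms need not be real.
  have hcard : Fintype.card {j // P.col j ≠ 0} + 1 ≤ n := by
    set w : Option {j // P.col j ≠ 0} → ι → ℂ :=
      fun o => o.elim (fun i => (e i : ℂ)) (fun j i => (P.col j.1 i : ℂ)) with hw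
    have hli : LinearIndependent ℂ w := by
      refine linearIndependent_of_dotProduct ?_ ?_
      · rintro (_ | i) (_ | j) hij
        · exact absurd rfl hij
        · simp only [hw, Option.elim, ofReal_comp_dotProduct, heP, Complex.ofReal_zero]
        · simp only [hw, Option.elim, ofReal_comp_dotProduct, dotProduct_comm _ e, heP,
            Complex.ofReal_zero]
        · simp only [hw, Option.elim, ofReal_comp_dotProduct]
          rw [hPoff _ _ (fun h => hij (congrArg some (Subtype.ext h))), Complex.ofReal_zero]
      · rintro (_ | i)
        · simp only [hw, Option.elim, ofReal_comp_dotProduct, hee, Complex.ofReal_one]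
          exact one_ne_zero
        · simp only [hw, Option.elim, ofReal_comp_dotProduct]
          exact Complex.ofReal_ne_zero.2 fun h => i.2 (dotProduct_self_eq_zero.1 h)
    have hspan : Submodule.span ℂ (Set.range w) ≤ Submodule.span ℂ (Set.range a) := by
      rw [Submodule.span_le]
      rintro _ ⟨_ | j, rfl⟩
      · have := hmem f
        rwa [hf] at this
      · have := hmem (V.col j.1)
        rwa [hTP _ j.2] at this
    have h1 := Submodule.finrank_mono hspan
    rw [finrank_span_eq_card hli, Fintype.card_option] at h1
    have h2 : Module.finrank ℂ (Submodule.span ℂ (Set.range a)) ≤ Fintype.card (Fin n) :=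
      finrank_range_le_card a
    rw [Fintype.card_fin] at h2
    exact h1.trans h2
  obtain ⟨n, rfl⟩ : ∃ n', n = n' + 1 := ⟨n - 1, by omega⟩
  obtain ⟨g⟩ : Nonempty ({j // P.col j ≠ 0} ↪ Fin n) :=
    Function.Embedding.nonempty_of_card_le (by rw [Fintype.card_fin]; omega)
  -- Unused indices receive zero vectors, which keep the number of terms and all orthogonality
  -- relations.
  set C : Fin n → ι → ℝ := Function.extend g (fun j => P.col j.1) 0 with hC
  set D : Fin n → κ → ℝ := Function.extend g (fun j => V.col j.1) 0 with hD
  have hCg : ∀ j, C (g j) = P.col j.1 := fun j => g.injective.extend_apply _ _ j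
  have hDg : ∀ j, D (g j) = V.col j.1 := fun j => g.injective.extend_apply _ _ j
  have hC0 : ∀ i, (¬ ∃ j, g j = i) → C i = 0 := fun i hi => Function.extend_apply' _ _ _ hi
  have hD0 : ∀ i, (¬ ∃ j, g j = i) → D i = 0 := fun i hi => Function.extend_apply' _ _ _ hi
  refine ⟨Nat.succ_pos n, Fin.cons e C, Fin.cons f D, ?_, rfl, rfl, ?_⟩
  · rw [Fin.sum_univ_succ]
    simp only [Fin.cons_zero, Fin.cons_succ]
    have h1 : ∑ j : {j // P.col j ≠ 0}, vecMulVec (P.col j.1) (V.col j.1) =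
        ∑ i, vecMulVec (C i) (D i) :=
      Fintype.sum_of_injective g g.injective _ _
        (fun i hi => by rw [hC0 i hi, zero_vecMulVec]) (fun j => by rw [hCg, hDg])
    have h2 : ∑ j : {j // P.col j ≠ 0}, vecMulVec (P.col j.1) (V.col j.1) =
        ∑ j, vecMulVec (P.col j) (V.col j) :=
      Fintype.sum_of_injective Subtype.val Subtype.val_injective _ _
        (fun i hi => by
          have : P.col i = 0 := by
            by_contra hne
            exact hi ⟨⟨i, hne⟩, rfl⟩
          rw [this, zero_vecMulVec]) (fun _ => rfl)
    have h3 : ∑ j, vecMulVec (P.col j) (V.col j) = N := by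
      rw [hNP]
      ext p q
      simp [Matrix.sum_apply, vecMulVec_apply, Matrix.mul_apply]
    rw [← h1, h2, h3, hN, add_sub_cancel]
  · have heC : ∀ i, e ⬝ᵥ C i = 0 := by
      intro i
      by_cases hi : ∃ j, g j = i
      · obtain ⟨j, rfl⟩ := hi
        rw [hCg, heP]
      · rw [hC0 i hi, dotProduct_zero]
    have hfD : ∀ i, f ⬝ᵥ D i = 0 := by
      intro i
      by_cases hi : ∃ j, g j = i
      · obtain ⟨j, rfl⟩ := hi
        rw [hDg, hfV _ j.2]
      · rw [hD0 i hi, dotProduct_zero]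
    intro i j
    refine Fin.cases ?_ (fun i => ?_) i <;> refine Fin.cases ?_ (fun j => ?_) j <;> intro hij
    · exact absurd rfl hij
    · exact ⟨heC j, hfD j⟩
    · simp only [Fin.cons_zero, Fin.cons_succ]
      exact ⟨by rw [dotProduct_comm, heC], by rw [dotProduct_comm, hfD]⟩
    · simp only [Fin.cons_succ]
      by_cases hi : ∃ i', g i' = i
      · by_cases hj : ∃ j', g j' = j
        · obtain ⟨i', rfl⟩ := hi
          obtain ⟨j', rfl⟩ := hj
          have hne : i'.1 ≠ j'.1 := fun h => hij (by rw [Subtype.ext h])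
          rw [hCg, hCg, hDg, hDg]
          exact ⟨hPoff _ _ hne, hVoff _ _ hne⟩
        · rw [hC0 j hj, hD0 j hj]
          simp
      · rw [hC0 i hi, hD0 i hi]
        simp

/-- The Hermitian matrix with real coordinates `v`; this is an isometry for the trace form. -/
noncomputable def hermitianOfReal {ι : Type*} (v : ι × ι → ℝ) : Matrix ι ι ℂ :=
  Matrix.of fun p q => (1 + Complex.I) / 2 * v (p, q) + (1 - Complex.I) / 2 * v (q, p)

lemma trace_hermitianOfReal_mul {ι : Type*} [Fintype ι] (v w : ι × ι → ℝ) :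
    (hermitianOfReal v * hermitianOfReal w).trace = ((v ⬝ᵥ w : ℝ) : ℂ) := by
  have hI := Complex.I_sq
  have h1 : (∑ p, ∑ q, (v (q, p) : ℂ) * w (q, p)) = ∑ p, ∑ q, (v (p, q) : ℂ) * w (p, q) :=
    Finset.sum_comm
  have h2 : (∑ p, ∑ q, (v (q, p) : ℂ) * w (p, q)) = ∑ p, ∑ q, (v (p, q) : ℂ) * w (q, p) :=
    Finset.sum_comm
  have h3 : (hermitianOfReal v * hermitianOfReal w).trace =
      ∑ p, ∑ q, (Complex.I / 2 * (v (p, q) * w (q, p)) + 1 / 2 * (v (p, q) * w (p, q)) +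
        (1 / 2 * (v (q, p) * w (q, p)) - Complex.I / 2 * (v (q, p) * w (p, q)))) := by
    simp only [Matrix.trace, diag_apply, Matrix.mul_apply, hermitianOfReal, of_apply]
    refine Finset.sum_congr rfl fun p _ => Finset.sum_congr rfl fun q _ => ?_
    linear_combination (1 / 4 * (v (p, q) * w (q, p) + v (q, p) * w (p, q) -
      v (p, q) * w (p, q) - v (q, p) * w (q, p) : ℂ)) * hI
  rw [h3]
  simp only [Finset.sum_add_distrib, Finset.sum_sub_distrib, ← Finset.mul_sum]
  rw [h1, h2]
  simp only [dotProduct, Fintype.sum_prod_type, Complex.ofReal_sum, Complex.ofReal_mul]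
  ring

/-- The coordinates of a Hermitian element of `M_k ⊗ M_m` in a product of trace-orthonormal
Hermitian bases. -/
noncomputable def realCoordinates {ι κ : Type*} (M : Matrix (ι × κ) (ι × κ) ℂ) :
    Matrix (ι × ι) (κ × κ) ℝ :=
  Matrix.of fun x y => ((M (x.1, y.2) (x.2, y.1) + M (x.2, y.1) (x.1, y.2)) / 2 +
    Complex.I / 2 * (M (x.2, y.2) (x.1, y.1) - M (x.1, y.1) (x.2, y.2))).re

lemma Matrix.IsHermitian.ofReal_realCoordinates {ι κ : Type*} {M : Matrix (ι × κ) (ι × κ) ℂ}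
    (hM : M.IsHermitian) (x : ι × ι) (y : κ × κ) :
    (realCoordinates M x y : ℂ) = (M (x.1, y.2) (x.2, y.1) + M (x.2, y.1) (x.1, y.2)) / 2 +
      Complex.I / 2 * (M (x.2, y.2) (x.1, y.1) - M (x.1, y.1) (x.2, y.2)) := by
  rw [realCoordinates, of_apply]
  refine Complex.conj_eq_iff_re.1 ?_
  have h : ∀ p q, (starRingEnd ℂ) (M p q) = M q p := fun p q => hM.apply q p
  simp only [map_add, map_sub, map_mul, map_div₀, h, Complex.conj_I, map_ofNat]
  ring

/-- Each factor on the right is the trace pairing of `A l` or `B l` with the basis `hermitianOfReal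
(Pi.single x 1)`. The `A l` and `B l` need not be Hermitian, so these coordinates are complex
although those of `M` are real. -/
lemma Matrix.IsHermitian.realCoordinates_map_eq_sum {ι κ : Type*} {n : ℕ}
    {M : Matrix (ι × κ) (ι × κ) ℂ} (hM : M.IsHermitian) {A : Fin n → Matrix ι ι ℂ}
    {B : Fin n → Matrix κ κ ℂ} (h : M = ∑ l, A l ⊗ₖ B l) :
    (realCoordinates M).map Complex.ofReal = ∑ l, vecMulVec
      (fun x => (1 - Complex.I) / 2 * A l x.1 x.2 + (1 + Complex.I) / 2 * A l x.2 x.1)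
      (fun y => (1 - Complex.I) / 2 * B l y.1 y.2 + (1 + Complex.I) / 2 * B l y.2 y.1) := by
  ext x y
  rw [map_apply, hM.ofReal_realCoordinates, h]
  simp only [Matrix.sum_apply, kroneckerMap_apply, vecMulVec_apply, ← Finset.sum_add_distrib,
    ← Finset.sum_sub_distrib, Finset.mul_sum, Finset.sum_div]
  refine Finset.sum_congr rfl fun l _ => ?_
  linear_combination (1 / 4 * (A l x.1 x.2 * B l y.2 y.1 + A l x.2 x.1 * B l y.1 y.2 -
    A l x.1 x.2 * B l y.1 y.2 - A l x.2 x.1 * B l y.2 y.1)) * Complex.I_sq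

lemma Matrix.IsHermitian.eq_sum_kronecker_hermitianOfReal {ι κ : Type*} {n : ℕ}
    {M : Matrix (ι × κ) (ι × κ) ℂ} (hM : M.IsHermitian) {c : Fin n → ι × ι → ℝ}
    {d : Fin n → κ × κ → ℝ} (h : realCoordinates M = ∑ l, vecMulVec (c l) (d l)) :
    M = ∑ l, hermitianOfReal (c l) ⊗ₖ hermitianOfReal (d l) := by
  have hT : ∀ x y, (realCoordinates M x y : ℂ) = ∑ l, (c l x : ℂ) * d l y := by
    intro x y
    rw [h]
    simp [Matrix.sum_apply, vecMulVec_apply]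
  ext ⟨p, r⟩ ⟨q, s⟩
  have h1 : (∑ l, hermitianOfReal (c l) ⊗ₖ hermitianOfReal (d l)) (p, r) (q, s) =
      Complex.I / 2 * realCoordinates M (p, q) (r, s) +
      1 / 2 * realCoordinates M (p, q) (s, r) + 1 / 2 * realCoordinates M (q, p) (r, s) -
      Complex.I / 2 * realCoordinates M (q, p) (s, r) := by
    simp only [hT, Matrix.sum_apply, kroneckerMap_apply, hermitianOfReal, of_apply,
      ← Finset.sum_add_distrib, ← Finset.sum_sub_distrib, Finset.mul_sum]
    refine Finset.sum_congr rfl fun l _ => ?_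
    linear_combination (1 / 4 * (c l (p, q) * d l (r, s) + c l (q, p) * d l (s, r) -
      c l (p, q) * d l (s, r) - c l (q, p) * d l (r, s) : ℂ)) * Complex.I_sq
  rw [h1]
  simp only [hM.ofReal_realCoordinates]
  linear_combination (1 / 2 * (M (p, r) (q, s) - M (q, s) (p, r))) * Complex.I_sq

end SchmidtDecomposition

/-! ### Assembling the normal form -/

open Matrix in
/-- A Hermitian matrix with scalar partial traces of the right size has an orthogonal operator
Schmidt decomposition which begins with the normalised identities. -/
lemma Matrix.IsHermitian.exists_orthogonal_kronecker_sum {k m n : ℕ}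
    {M : Matrix (Fin k × Fin m) (Fin k × Fin m) ℂ} (hM : M.IsHermitian) (hk : 0 < k) (hm : 0 < m)
    {A : Fin n → Matrix (Fin k) (Fin k) ℂ} {B : Fin n → Matrix (Fin m) (Fin m) ℂ}
    (hAB : M = ∑ l, A l ⊗ₖ B l)
    (h1 : partialTraceSnd M = ((√m / √k : ℝ) : ℂ) • 1)
    (h2 : partialTraceFst M = ((√k / √m : ℝ) : ℂ) • 1) :
    ∃ (C : Fin n → Matrix (Fin k) (Fin k) ℂ) (D : Fin n → Matrix (Fin m) (Fin m) ℂ),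
      M = ∑ i, C i ⊗ₖ D i ∧
      (∃ hn : 0 < n, C ⟨0, hn⟩ = ((√k : ℝ) : ℂ)⁻¹ • (1 : Matrix (Fin k) (Fin k) ℂ) ∧
        D ⟨0, hn⟩ = ((√m : ℝ) : ℂ)⁻¹ • (1 : Matrix (Fin m) (Fin m) ℂ)) ∧
      ∀ i j, i ≠ j → (C i * C j).trace = 0 ∧ (D i * D j).trace = 0 := by
  have hsk : 0 < √(k : ℝ) := Real.sqrt_pos.2 (by exact_mod_cast hk)
  have hsm : 0 < √(m : ℝ) := Real.sqrt_pos.2 (by exact_mod_cast hm)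
  have hkk : √(k : ℝ) ^ 2 = k := Real.sq_sqrt (Nat.cast_nonneg _)
  -- `e` and `f` are the real coordinates of `Id/√k` and `Id/√m`.
  set e : Fin k × Fin k → ℝ := fun x => if x.1 = x.2 then (√k)⁻¹ else 0 with he
  set f : Fin m × Fin m → ℝ := fun x => if x.1 = x.2 then (√m)⁻¹ else 0 with hf
  have hherm : ∀ (l : ℕ), hermitianOfReal (fun x : Fin l × Fin l =>
      if x.1 = x.2 then (√(l : ℝ))⁻¹ else 0) = ((√l : ℝ) : ℂ)⁻¹ • 1 := by
    intro l
    ext p q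
    by_cases hpq : p = q
    · subst hpq
      simp [hermitianOfReal]
      ring
    · simp [hermitianOfReal, hpq, Ne.symm hpq]
  have hs1 : ∀ p q, ∑ r, M (p, r) (q, r) = if p = q then ((√m / √k : ℝ) : ℂ) else 0 := by
    intro p q
    have := congrFun (congrFun h1 p) q
    simpa [partialTraceSnd, one_apply] using this
  have hs2 : ∀ r s, ∑ p, M (p, r) (p, s) = if r = s then ((√k / √m : ℝ) : ℂ) else 0 := by
    intro r s
    have := congrFun (congrFun h2 r) s
    simpa [partialTraceFst, one_apply] using this
  -- Contracting the second factor with the identity is a partial trace, so `h1` says that `f` is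
  -- sent to `e`; `h2` gives the transposed relation.
  have hTf : realCoordinates M *ᵥ f = e := by
    ext ⟨p, q⟩
    apply Complex.ofReal_injective
    have h3 : ((∑ r, realCoordinates M (p, q) (r, r) : ℝ) : ℂ) =
        if p = q then ((√m / √k : ℝ) : ℂ) else 0 := by
      rw [Complex.ofReal_sum]
      simp only [hM.ofReal_realCoordinates, Finset.sum_add_distrib, ← Finset.mul_sum,
        ← Finset.sum_div, Finset.sum_sub_distrib, hs1]
      by_cases hpq : p = q
      · simp [hpq]
      · simp [hpq, Ne.symm hpq]
    have h4 : (realCoordinates M *ᵥ f) (p, q) = (∑ r, realCoordinates M (p, q) (r, r)) * (√m)⁻¹ := by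
      simp [mulVec, dotProduct, Fintype.sum_prod_type, hf, Finset.sum_mul]
    rw [h4, Complex.ofReal_mul, h3, he]
    by_cases hpq : p = q
    · simp only [hpq, if_true]
      rw [← Complex.ofReal_mul]
      congr 1
      field_simp
    · simp [hpq]
  have heT : e ᵥ* realCoordinates M = f := by
    ext ⟨r, s⟩
    apply Complex.ofReal_injective
    have h3 : ((∑ p, realCoordinates M (p, p) (r, s) : ℝ) : ℂ) =
        if r = s then ((√k / √m : ℝ) : ℂ) else 0 := by
      rw [Complex.ofReal_sum]
      simp only [hM.ofReal_realCoordinates, Finset.sum_add_distrib, ← Finset.mul_sum,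
        ← Finset.sum_div, Finset.sum_sub_distrib, hs2]
      by_cases hrs : r = s
      · simp [hrs]
      · simp [hrs, Ne.symm hrs]
    have h4 : (e ᵥ* realCoordinates M) (r, s) = (√k)⁻¹ * (∑ p, realCoordinates M (p, p) (r, s)) := by
      simp [vecMul, dotProduct, Fintype.sum_prod_type, he, Finset.mul_sum]
    rw [h4, Complex.ofReal_mul, h3, hf]
    by_cases hrs : r = s
    · simp only [hrs, if_true]
      rw [← Complex.ofReal_mul]
      congr 1
      field_simp
    · simp [hrs]
  have hee : e ⬝ᵥ e = 1 := by
    have : e ⬝ᵥ e = k * ((√k)⁻¹ * (√k)⁻¹) := by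
      simp [dotProduct, Fintype.sum_prod_type, he]
    rw [this]
    field_simp
    linarith
  obtain ⟨hn, c, d, hcd, hc0, hd0, horth⟩ :=
    exists_orthogonal_sum_vecMulVec hTf heT hee (hM.realCoordinates_map_eq_sum hAB)
  refine ⟨fun i => hermitianOfReal (c i), fun i => hermitianOfReal (d i),
    hM.eq_sum_kronecker_hermitianOfReal hcd, ⟨hn, ?_, ?_⟩, fun i j hij => ?_⟩
  · simp only [hc0, he, hherm]
  · simp only [hd0, hf, hherm]
  · simp only [trace_hermitianOfReal_mul, (horth i j hij).1, (horth i j hij).2,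
      Complex.ofReal_zero, and_self]

theorem theorem4p3 (k m n : ℕ)
    (A : Matrix (Fin k × Fin m) (Fin k × Fin m) ℂ)
    (A' : Fin n → Matrix (Fin k) (Fin k) ℂ) (B' : Fin n → Matrix (Fin m) (Fin m) ℂ)
    (hsum : A = ∑ i, A' i ⊗ₖ B' i) (hA : A.PosSemidef)
    (hker : (k ≠ m ∧ Module.finrank ℂ (LinearMap.ker A.mulVecLin) < min k m) ∨
      (k = m ∧ Module.finrank ℂ (LinearMap.ker A.mulVecLin) + 1 < k)) :
    HasFilterNormalForm n A := by
  obtain ⟨X, Y, hX, hY, h1, h2⟩ := exists_scalar_partialTraces hA hker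
  refine ⟨X, Y, hX, hY, ?_⟩
  -- Local conjugation acts term by term, so the scaled matrix is again a sum of `n` products.
  refine (hA.mul_mul_conjTranspose_same (X ⊗ₖ Y)).isHermitian.exists_orthogonal_kronecker_sum
    (A := fun l => X * A' l * X.conjTranspose) (B := fun l => Y * B' l * Y.conjTranspose)
    (by omega) (by omega) ?_ h1 h2
  rw [hsum, Finset.mul_sum, Finset.sum_mul]
  refine Finset.sum_congr rfl fun l _ => ?_
  rw [Matrix.conjTranspose_kronecker, ← Matrix.mul_kronecker_mul, ← Matrix.mul_kronecker_mul]
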